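/- Let $k$ be a field of characteristic $0$, let $m\ge 0$, let $R=k[[t,x_1,\dots,x_m]]$ be the formal power series ring in $m+1$ indeterminates, and let $S=k[[t^2,x_1,\dots,x_m]]\subseteq R$. Let $f_1(t),\dots,f_m(t)\in k[[t]]$ be power series with zero constant term, and put $$Q_1=(x_1-f_1(t),\dots,x_m-f_m(t))R,\qquad Q_2=(x_1-f_1(-t),\dots,x_m-f_m(-t))R.$$ Let $\sigma:R\to R$ be the automorphism of formal power series over $k$ with $\sigma(t)=-t$ and $\sigma(x_i)=x_i$ for $1\le i\le m$. Then $Q_1$ and $Q_2$ are prime ideals of $R$ that are conjugate under $\sigma$: $\sigma(Q_1)=Q_2$ and $\sigma(Q_2)=Q_1$. Further, $Q_1$ and $Q_2$ contract to the same prime ideal $P$ of $S$: $$P=Q_1\cap S=Q_2\cap S=(Q_1\cap Q_2)\cap S.$$ Let $\mathfrak m=(t^2,x_1,\dots,x_m)S$. Then $$P^{(2)}\subseteq \mathfrak m P .$$ Here, for an ideal $I$ of a ring $A$ and a positive integer $n$, the $n$-th symbolic power is $I^{(n)}=\{r\in A : r/1\in I^nA_{\mathfrak p}\text{ for every associated prime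 }\mathfrak p\text{ of } I\}$. -/

import Mathlib

noncomputable section

namespace EisenbudMazur

/-- The `n`-th symbolic power of an ideal `I` of `A`: the elements `r` of `A` such that `r / 1` lies
in `I ^ n A_p` for every associated prime `p` of `I`, i.e. of the `A`-module `A ⧸ I`. -/
def symbolicPower {A : Type*} [CommRing A] (I : Ideal A) (n : ℕ) : Ideal A :=
  ⨅ (p : Ideal A) (hp : p ∈ associatedPrimes A (A ⧸ I)),
    haveI : p.IsPrime := hp.isPrime
    ((I ^ n).map (algebraMap A (Localization.AtPrime p))).comap
      (algebraMap A (Localization.AtPrime p))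

theorem mem_symbolicPower {A : Type*} [CommRing A] (I : Ideal A) (n : ℕ) (r : A) :
    r ∈ symbolicPower I n ↔ ∀ (p : Ideal A) (hp : p ∈ associatedPrimes A (A ⧸ I)),
      haveI : p.IsPrime := hp.isPrime
      algebraMap A (Localization.AtPrime p) r ∈
        (I ^ n).map (algebraMap A (Localization.AtPrime p)) := by
  simp [symbolicPower, Ideal.mem_comap]

variable (k : Type*) [Field k] (m : ℕ)

/-- The formal power series ring `R = k[[t, x₁, …, xₘ]]`, with variables indexed by
`0` (for `t`) and `1, …, m` (for `x₁, …, xₘ`). -/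
abbrev R : Type _ := MvPowerSeries (Fin (m + 1)) k

/-- The variable `t` of `R`. -/
def t : R k m := MvPowerSeries.X 0

/-- The variables `x₁, …, xₘ` of `R`. -/
def x (i : Fin m) : R k m := MvPowerSeries.X i.succ

theorem hasSubst_sq : MvPowerSeries.HasSubst (Fin.cons (t k m ^ 2) (x k m) : Fin (m + 1) → R k m) :=
  MvPowerSeries.hasSubst_of_constantCoeff_zero fun i => by
    refine Fin.cases ?_ (fun j => ?_) i <;> simp [t, x]

theorem hasSubst_neg : MvPowerSeries.HasSubst (Fin.cons (-t k m) (x k m) : Fin (m + 1) → R k m) :=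
  MvPowerSeries.hasSubst_of_constantCoeff_zero fun i => by
    refine Fin.cases ?_ (fun j => ?_) i <;> simp [t, x]

/-- The substitution `F(t, x₁, …, xₘ) ↦ F(t², x₁, …, xₘ)`. -/
def substSq : R k m →ₐ[k] R k m := MvPowerSeries.substAlgHom (hasSubst_sq k m)

/-- The subring `S = k[[t², x₁, …, xₘ]]` of `R`: all power series `F(t², x₁, …, xₘ)`. -/
def S : Subalgebra k (R k m) := (substSq k m).range

/-- The substitution `F(t, x₁, …, xₘ) ↦ F(-t, x₁, …, xₘ)`. -/
def substNeg : R k m →ₐ[k] R k m := MvPowerSeries.substAlgHom (hasSubst_neg k m)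

theorem substNeg_t : substNeg k m (t k m) = -t k m := by
  exact MvPowerSeries.substAlgHom_X (hasSubst_neg k m) 0

theorem substNeg_x (i : Fin m) : substNeg k m (x k m i) = x k m i := by
  exact MvPowerSeries.substAlgHom_X (hasSubst_neg k m) i.succ

theorem substNeg_comp_self : (substNeg k m).comp (substNeg k m) = AlgHom.id k (R k m) := by
  have key : (fun i => MvPowerSeries.subst (Fin.cons (-t k m) (x k m) : Fin (m + 1) → R k m)
      ((Fin.cons (-t k m) (x k m) : Fin (m + 1) → R k m) i)) =
      (MvPowerSeries.X : Fin (m + 1) → R k m) := by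
    funext i
    rw [← MvPowerSeries.substAlgHom_apply (hasSubst_neg k m)]
    change substNeg k m _ = _
    refine Fin.cases ?_ (fun j => ?_) i
    · simp only [Fin.cons_zero, map_neg, substNeg_t, neg_neg]; rfl
    · simp only [Fin.cons_succ, substNeg_x]; rfl
  ext1 F
  change substNeg k m (substNeg k m F) = F
  simp only [substNeg, MvPowerSeries.substAlgHom_apply]
  rw [MvPowerSeries.subst_comp_subst_apply (hasSubst_neg k m) (hasSubst_neg k m), key,
    MvPowerSeries.subst_self]
  rfl

/-- The automorphism `σ` of `R` with `σ(t) = -t` and `σ(xᵢ) = xᵢ`. -/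
def sigma : R k m ≃ₐ[k] R k m :=
  AlgEquiv.ofAlgHom (substNeg k m) (substNeg k m) (substNeg_comp_self k m) (substNeg_comp_self k m)

variable {k m}

/-- The ideal `Q₁ = (x₁ - f₁(t), …, xₘ - fₘ(t))R`. -/
def Q₁ (f : Fin m → PowerSeries k) : Ideal (R k m) :=
  Ideal.span (Set.range fun i => x k m i - PowerSeries.subst (t k m) (f i))

/-- The ideal `Q₂ = (x₁ - f₁(-t), …, xₘ - fₘ(-t))R`. -/
def Q₂ (f : Fin m → PowerSeries k) : Ideal (R k m) :=
  Ideal.span (Set.range fun i => x k m i - PowerSeries.subst (-t k m) (f i))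

/-- The contraction `J ∩ S` to `S` of an ideal `J` of `R`. -/
def contract (J : Ideal (R k m)) : Ideal (S k m) := J.comap (S k m).val

variable (k m)

theorem t_sq_mem : t k m ^ 2 ∈ S k m :=
  ⟨t k m, MvPowerSeries.substAlgHom_X (hasSubst_sq k m) 0⟩

theorem x_mem (i : Fin m) : x k m i ∈ S k m :=
  ⟨x k m i, MvPowerSeries.substAlgHom_X (hasSubst_sq k m) i.succ⟩

/-- The ideal `𝔪 = (t², x₁, …, xₘ)S` of `S`. -/
def maxIdeal : Ideal (S k m) :=
  Ideal.span (insert ⟨t k m ^ 2, t_sq_mem k m⟩ (Set.range fun i => ⟨x k m i, x_mem k m i⟩))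

end EisenbudMazur

end

/-!
Write `uᵢ = xᵢ - fᵢ(t)`, `vᵢ = σ uᵢ = xᵢ - fᵢ(-t)` and `Dᵢ = fᵢ(t) - fᵢ(-t)`. The ideal `Q₁` is the
kernel of evaluation on the curve `xᵢ = fᵢ(t)`, because the values of a power series at two points
are congruent modulo the differences of the coordinates (`subst_sub_subst_mem`). The ring `S`
consists of the `σ`-invariants (`mem_S_iff`), which settles the contractions of `Q₁` and `Q₂`.

The point is that `P` is a complete intersection with explicit generators. If all `Dᵢ` vanish, the
`uᵢ` lie in `S` and generate `P`. Otherwise some nonzero `Dⱼ` divides all `Dᵢ`, say `Dᵢ = Dⱼ cᵢ`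
with `cᵢ` an even series in `t`, as `k[[t]]` is a valuation ring (`exists_oddPart_dvd`). Then
`zᵢ = uᵢ - cᵢ uⱼ` is invariant, and `P` is generated by the `zᵢ` with `i ≠ j` and by `uⱼ vⱼ`
(`exists_coeff_of_mem_contract`).

An element `r` of `P⁽²⁾` vanishes to second order when the `i`-th coordinate of the curve is moved
by a parameter (`x_sq_dvd_deform`); this replaces the statement that derivations send `P⁽²⁾` into
`P`. Write `r` in terms of the generators. To first order, moving the `i`-th coordinate with `i ≠ j`
changes `zᵢ` alone, so the coefficient of `zᵢ` lies in `P`. Moving the `j`-th coordinate changes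
`uⱼ vⱼ` by `Dⱼ ≠ 0` times the parameter and the terms already treated only to second order, so the
coefficient of `uⱼ vⱼ` lies in `P` as well. Hence `r ∈ P²`, and
`P² ⊆ 𝔪 P` because the elements of `P` have zero constant term.
-/

noncomputable section

namespace EisenbudMazur

open MvPowerSeries

/-! ### Substitution into multivariate power series -/

/-- If every monomial of a series is divisible by a variable in `s`, the series lies in the ideal
that these variables generate: split off the monomials divisible by one variable at a time. -/
theorem mem_span_X_image {σ k : Type*} [Field k] (s : Finset σ) (G : MvPowerSeries σ k)
    (h : ∀ e : σ →₀ ℕ, (∀ i ∈ s, e i = 0) → coeff e G = 0) :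
    G ∈ Ideal.span ((fun i => (X i : MvPowerSeries σ k)) '' s) := by
  classical
  induction s using Finset.induction_on generalizing G with
  | empty =>
    have : G = 0 := by ext e; simpa using h e (by simp)
    simp [this]
  | insert a s ha ih =>
    let G₁ : MvPowerSeries σ k := fun e => if e a = 0 then 0 else coeff e G
    let G₀ : MvPowerSeries σ k := fun e => if e a = 0 then coeff e G else 0
    have hG : G = G₁ + G₀ := by
      ext e
      change coeff e G = (if e a = 0 then 0 else coeff e G) + (if e a = 0 then coeff e G else 0)
      split_ifs <;> simp
    rw [hG]
    refine add_mem ?_ ?_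
    · have : (X a : MvPowerSeries σ k) ∣ G₁ := X_dvd_iff.2 fun e he => if_pos he
      exact Ideal.mem_of_dvd _ this (Ideal.subset_span ⟨a, by simp, rfl⟩)
    · refine Ideal.span_mono (Set.image_mono (by simp)) (ih G₀ fun e he => ?_)
      change (if e a = 0 then coeff e G else 0) = 0
      split_ifs with h0
      · exact h e (by simpa [h0] using he)
      · rfl

/-- Modulo the first set of variables, a series equals its part in the second set of variables. -/
theorem sub_rename_killCompl_mem {σ k : Type*} [Finite σ] [Field k]
    (G : MvPowerSeries (σ ⊕ σ) k) :
    G - rename Function.Embedding.inr (killCompl Function.Embedding.inr G) ∈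
      Ideal.span (Set.range fun i => (X (Sum.inl i) : MvPowerSeries (σ ⊕ σ) k)) := by
  classical
  cases nonempty_fintype σ
  have := mem_span_X_image (Finset.univ.map (Function.Embedding.inl : σ ↪ σ ⊕ σ))
    (G - rename Function.Embedding.inr (killCompl Function.Embedding.inr G)) ?_
  · rw [Finset.coe_map, Finset.coe_univ, Set.image_univ, ← Set.range_comp] at this
    exact this
  · intro e he
    obtain ⟨d, rfl⟩ : ∃ d : σ →₀ ℕ, Finsupp.embDomain Function.Embedding.inr d = e := by
      refine ⟨e.comapDomain Sum.inr Sum.inr_injective.injOn, ?_⟩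
      ext i
      rcases i with i | i
      · rw [Finsupp.embDomain_of_notMem_range _ _ _ (by simp)]
        exact (he (Sum.inl i) (by simp)).symm
      · exact Finsupp.embDomain_apply_self Function.Embedding.inr _ i
    rw [map_sub, coeff_embDomain_rename, coeff_killCompl, sub_self]

/-- The series subtracted on the left is `F` itself with `b` substituted, as `subst_sub_subst_mem`
shows; leaving it in this form avoids computing `killCompl` on a substituted series. -/
theorem subst_sub_subst_killCompl_mem {σ τ k : Type*} [Finite σ] [Field k]
    {a b : σ → MvPowerSeries τ k} (ha : HasSubst a) (hb : HasSubst b) (F : MvPowerSeries σ k) :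
    subst a F - subst b (killCompl Function.Embedding.inr
        (subst (fun i => (X (Sum.inl i) + X (Sum.inr i) : MvPowerSeries (σ ⊕ σ) k)) F)) ∈
      Ideal.span (Set.range fun i => a i - b i) := by
  have hc : HasSubst (fun i => (X (Sum.inl i) + X (Sum.inr i) : MvPowerSeries (σ ⊕ σ) k)) :=
    hasSubst_of_constantCoeff_zero fun i => by simp
  have he : HasSubst (Sum.elim (fun i => a i - b i) b) := by
    refine ⟨fun s => ?_, fun d => Set.toFinite _⟩
    rcases s with i | i
    · simpa using (Commute.all _ _).isNilpotent_sub (ha.const_coeff i) (hb.const_coeff i)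
    · exact hb.const_coeff i
  have h := Ideal.mem_map_of_mem (substAlgHom he (R := k)) (sub_rename_killCompl_mem
    (subst (fun i => (X (Sum.inl i) + X (Sum.inr i) : MvPowerSeries (σ ⊕ σ) k)) F))
  rw [Ideal.map_span, ← Set.range_comp, map_sub, rename_eq_subst,
    substAlgHom_apply, substAlgHom_apply, subst_comp_subst_apply hc he,
    subst_comp_subst_apply (HasSubst.X_comp _) he] at h
  have h1 : (fun i => subst (Sum.elim (fun i => a i - b i) b)
      (X (Sum.inl i) + X (Sum.inr i) : MvPowerSeries (σ ⊕ σ) k)) = a := by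
    funext i
    rw [subst_add he, subst_X he, subst_X he, Sum.elim_inl, Sum.elim_inr, sub_add_cancel]
  have h2 : (fun i : σ => subst (Sum.elim (fun i => a i - b i) b)
      ((X ∘ Function.Embedding.inr) i : MvPowerSeries (σ ⊕ σ) k)) = b := by
    funext i
    exact subst_X he _
  have h3 : ((substAlgHom he (R := k)) ∘ fun i => (X (Sum.inl i) : MvPowerSeries (σ ⊕ σ) k)) =
      fun i => a i - b i := by
    funext i
    exact substAlgHom_X he _
  rwa [h1, h2, h3] at h

/-- The values of a power series at `a` and at `b` are congruent modulo the differences `a i - b i`.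
It is proved by specialising the expansion of `F(X + Y)` in a doubled set of variables along
`X ↦ a - b`, `Y ↦ b`. -/
theorem subst_sub_subst_mem {σ τ k : Type*} [Finite σ] [Field k]
    {a b : σ → MvPowerSeries τ k} (ha : HasSubst a) (hb : HasSubst b) (F : MvPowerSeries σ k) :
    subst a F - subst b F ∈ Ideal.span (Set.range fun i => a i - b i) := by
  -- The case `a = b = X`, where the ideal is zero, shows that the unknown series is `F`.
  have hK := subst_sub_subst_killCompl_mem (HasSubst.X (σ := σ) (S := k)) HasSubst.X F
  have h0 : Ideal.span (Set.range fun _ : σ => (0 : MvPowerSeries σ k)) = ⊥ := by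
    rw [Ideal.span_eq_bot]; rintro _ ⟨_, rfl⟩; rfl
  simp only [subst_self, id, sub_self] at hK
  rw [h0] at hK
  have := subst_sub_subst_killCompl_mem ha hb F
  rwa [← sub_eq_zero.1 hK] at this

variable {k : Type*} [Field k] {m : ℕ}

/-- The endomorphism of `R` that sends the variable with index `i` to `a i`. -/
def ev (a : Fin (m + 1) → R k m) (ha : ∀ i, constantCoeff (a i) = 0) : R k m →ₐ[k] R k m :=
  substAlgHom (hasSubst_of_constantCoeff_zero ha)

section ev

variable {a b : Fin (m + 1) → R k m} (ha : ∀ i, constantCoeff (a i) = 0)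
  (hb : ∀ i, constantCoeff (b i) = 0)

theorem ev_X (i : Fin (m + 1)) : ev a ha (X i) = a i := substAlgHom_X _ i

theorem ev_sub_ev_mem (F : R k m) :
    ev a ha F - ev b hb F ∈ Ideal.span (Set.range fun i => a i - b i) := by
  simpa only [ev, substAlgHom_apply] using
    subst_sub_subst_mem (hasSubst_of_constantCoeff_zero ha) (hasSubst_of_constantCoeff_zero hb) F

theorem ev_eq_self (h : ∀ i, a i = X i) (F : R k m) : ev a ha F = F := by
  obtain rfl : a = X := funext h
  simp [ev, substAlgHom_apply, subst_self]

theorem sub_ev_mem (F : R k m) :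
    F - ev a ha F ∈ Ideal.span (Set.range fun i => X i - a i) := by
  have hX : ∀ i : Fin (m + 1), constantCoeff (X i : R k m) = 0 := fun i => by simp
  have := ev_sub_ev_mem hX ha F
  rwa [ev_eq_self hX fun _ => rfl] at this

theorem ev_ev {c : Fin (m + 1) → R k m} (hc : ∀ i, constantCoeff (c i) = 0)
    (h : ∀ i, ev b hb (a i) = c i) (F : R k m) : ev b hb (ev a ha F) = ev c hc F := by
  obtain rfl : (fun i => ev b hb (a i)) = c := funext h
  simp only [ev, substAlgHom_apply]
  exact subst_comp_subst_apply (hasSubst_of_constantCoeff_zero ha)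
    (hasSubst_of_constantCoeff_zero hb) F

theorem ev_powerSeries_subst {u : R k m} (hu : constantCoeff u = 0) (g : PowerSeries k) :
    ev a ha (PowerSeries.subst u g) = PowerSeries.subst (ev a ha u) g := by
  simp only [ev, substAlgHom_apply, PowerSeries.subst]
  exact subst_comp_subst_apply (PowerSeries.HasSubst.of_constantCoeff_zero hu).const
    (hasSubst_of_constantCoeff_zero ha) g

end ev

/-! ### The involution `σ` and its invariants -/

theorem constantCoeff_cons_neg (i : Fin (m + 1)) :
    constantCoeff ((Fin.cons (-t k m) (x k m) : Fin (m + 1) → R k m) i) = 0 := by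
  refine Fin.cases ?_ (fun j => ?_) i <;> simp [t, x]

theorem sigma_eq_ev (F : R k m) : sigma k m F = ev _ constantCoeff_cons_neg F := rfl

theorem sigma_t : sigma k m (t k m) = -t k m := substNeg_t k m

theorem sigma_x (i : Fin m) : sigma k m (x k m i) = x k m i := substNeg_x k m i

theorem sigma_sigma (F : R k m) : sigma k m (sigma k m F) = F :=
  (sigma k m).symm_apply_apply F

theorem coeff_sigma (F : R k m) (e : Fin (m + 1) →₀ ℕ) :
    coeff e (sigma k m F) = (-1) ^ e 0 * coeff e F := by
  have h : sigma k m F = rescale (Fin.cons (-1) 1 : Fin (m + 1) → k) F := by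
    rw [rescale_eq_subst]
    change substAlgHom (hasSubst_neg k m) F = _
    rw [substAlgHom_apply]
    congr 1
    funext i
    refine Fin.cases ?_ (fun j => ?_) i <;> simp [t, x]
  rw [h, coeff_rescale]
  congr 1
  rw [Finsupp.prod_fintype _ _ (by simp), Fin.prod_univ_succ]
  simp

theorem sigma_substSq (F : R k m) : sigma k m (substSq k m F) = substSq k m F := by
  have hs : ∀ i, constantCoeff ((Fin.cons (t k m ^ 2) (x k m) : Fin (m + 1) → R k m) i) = 0 :=
    fun i => by refine Fin.cases ?_ (fun j => ?_) i <;> simp [t, x]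
  change ev _ constantCoeff_cons_neg (ev _ hs F) = ev _ hs F
  refine ev_ev hs constantCoeff_cons_neg hs (fun i => ?_) F
  rw [← sigma_eq_ev]
  refine Fin.cases ?_ (fun j => ?_) i
  · simp [sigma_t]
  · simp [sigma_x]

theorem sigma_eq_self_of_mem_S {F : R k m} (hF : F ∈ S k m) : sigma k m F = F := by
  obtain ⟨G, rfl⟩ := hF
  exact sigma_substSq G

/-- A series that is even in `t` is a series in `t²`. -/
theorem mem_S_of_coeff_eq_zero {F : R k m}
    (hF : ∀ e : Fin (m + 1) →₀ ℕ, Odd (e 0) → coeff e F = 0) : F ∈ S k m := by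
  classical
  -- `dbl` doubles the exponent of `t`, so `substSq` sends the monomial `d` to the monomial `dbl d`.
  let w : Fin (m + 1) → ℕ := Fin.cons 2 1
  let dbl : (Fin (m + 1) →₀ ℕ) → (Fin (m + 1) →₀ ℕ) :=
    fun d => Finsupp.equivFunOnFinite.symm fun i => w i * d i
  have hw : ∀ i, 0 < w i := fun i => by refine Fin.cases ?_ (fun j => ?_) i <;> simp [w]
  have hdbl : Function.Injective dbl := fun d d' h => by
    ext i
    have := DFunLike.congr_fun h i
    exact Nat.eq_of_mul_eq_mul_left (hw i) this
  have hprod (d : Fin (m + 1) →₀ ℕ) :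
      (d.prod fun s e => (Fin.cons (t k m ^ 2) (x k m) : Fin (m + 1) → R k m) s ^ e) =
        monomial (dbl d) 1 := by
    rw [monomial_one_eq, Finsupp.prod_fintype _ _ (by simp), Finsupp.prod_fintype _ _ (by simp)]
    refine Finset.prod_congr rfl fun i _ => ?_
    change _ = X i ^ (w i * d i)
    rw [pow_mul]
    congr 1
    refine Fin.cases ?_ (fun j => ?_) i <;> simp [w, t, x]
  let G : R k m := fun d => coeff (dbl d) F
  refine ⟨G, ?_⟩
  ext e
  change coeff e (substAlgHom (hasSubst_sq k m) G) = _
  rw [substAlgHom_apply, coeff_subst (hasSubst_sq k m)]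
  simp only [hprod, coeff_monomial]
  by_cases he : ∃ d, dbl d = e
  · obtain ⟨d, rfl⟩ := he
    rw [finsum_eq_single _ d fun d' hd' => by simp [hdbl.ne_iff.2 hd'.symm]]
    rw [if_pos rfl, smul_eq_mul, mul_one]
    rfl
  · have h0 : Odd (e 0) := by
      by_contra h
      obtain ⟨r, hr⟩ := Nat.not_odd_iff_even.1 h
      refine he ⟨Finsupp.equivFunOnFinite.symm (Fin.cons r fun j => e j.succ), ?_⟩
      ext i
      refine Fin.cases ?_ (fun j => ?_) i <;> simp [dbl, w, hr, two_mul]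
    rw [hF e h0]
    refine finsum_eq_zero_of_forall_eq_zero fun d => ?_
    rw [if_neg fun h => he ⟨d, h.symm⟩, smul_zero]

/-- `S` is the ring of invariants of `σ`. -/
theorem mem_S_iff [CharZero k] {F : R k m} : F ∈ S k m ↔ sigma k m F = F := by
  refine ⟨sigma_eq_self_of_mem_S, fun h => mem_S_of_coeff_eq_zero fun e he => ?_⟩
  have := coeff_sigma F e
  rw [h, he.neg_one_pow, neg_one_mul] at this
  exact self_eq_neg.1 this

/-! ### Substitutions fixing `t` -/

theorem constantCoeff_cons_t {y : Fin m → R k m} (hy : ∀ i, constantCoeff (y i) = 0)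
    (i : Fin (m + 1)) : constantCoeff ((Fin.cons (t k m) y : Fin (m + 1) → R k m) i) = 0 := by
  refine Fin.cases ?_ (fun j => ?_) i <;> simp [t, hy]

/-- The endomorphism of `R` that fixes `t` and sends `xᵢ` to `y i`. -/
def evx (y : Fin m → R k m) (hy : ∀ i, constantCoeff (y i) = 0) : R k m →ₐ[k] R k m :=
  ev (Fin.cons (t k m) y) (constantCoeff_cons_t hy)

section evx

variable {y z : Fin m → R k m} (hy : ∀ i, constantCoeff (y i) = 0)
  (hz : ∀ i, constantCoeff (z i) = 0)

theorem evx_t : evx y hy (t k m) = t k m := ev_X (constantCoeff_cons_t hy) 0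

theorem evx_x (i : Fin m) : evx y hy (x k m i) = y i := ev_X (constantCoeff_cons_t hy) i.succ

theorem evx_evx {w : Fin m → R k m} (hw : ∀ i, constantCoeff (w i) = 0)
    (h : ∀ i, evx z hz (y i) = w i) (F : R k m) : evx z hz (evx y hy F) = evx w hw F :=
  ev_ev _ _ _ (fun i => by
    refine Fin.cases ?_ (fun j => ?_) i
    · exact evx_t hz
    · exact h j) F

theorem sub_evx_mem {J : Ideal (R k m)} (h : ∀ i, x k m i - y i ∈ J) (F : R k m) :
    F - evx y hy F ∈ J := by
  refine Ideal.span_le.2 ?_ (sub_ev_mem (constantCoeff_cons_t hy) F)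
  rintro _ ⟨i, rfl⟩
  refine Fin.cases ?_ (fun j => ?_) i
  · simp [t]
  · simpa [x] using h j

theorem constantCoeff_t : constantCoeff (t k m) = 0 := by simp [t]

theorem constantCoeff_x (i : Fin m) : constantCoeff (x k m i) = 0 := by simp [x]

theorem evx_subst_t (g : PowerSeries k) :
    evx y hy (PowerSeries.subst (t k m) g) = PowerSeries.subst (t k m) g := by
  rw [evx, ev_powerSeries_subst _ constantCoeff_t]
  congr 1
  exact evx_t hy

theorem evx_subst_neg_t (g : PowerSeries k) :
    evx y hy (PowerSeries.subst (-t k m) g) = PowerSeries.subst (-t k m) g := by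
  rw [evx, ev_powerSeries_subst _ (by simp [constantCoeff_t])]
  congr 1
  rw [map_neg]
  exact congrArg _ (evx_t hy)

end evx

theorem sigma_subst_t (g : PowerSeries k) :
    sigma k m (PowerSeries.subst (t k m) g) = PowerSeries.subst (-t k m) g := by
  rw [sigma_eq_ev, ev_powerSeries_subst _ constantCoeff_t]
  congr 1
  exact sigma_t

theorem sigma_subst_neg_t (g : PowerSeries k) :
    sigma k m (PowerSeries.subst (-t k m) g) = PowerSeries.subst (t k m) g := by
  rw [← sigma_subst_t, sigma_sigma]

theorem constantCoeff_update_x (i : Fin m) {g : R k m} (hg : constantCoeff g = 0) (l : Fin m) :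
    constantCoeff (Function.update (x k m) i g l) = 0 := by
  rcases eq_or_ne l i with rfl | h
  · simp [hg]
  · simp [h, constantCoeff_x]

/-- The factor theorem for `xᵢ - g`. The series `g` may involve `xᵢ` itself. -/
theorem x_sub_dvd {i : Fin m} {g : R k m} (hg : constantCoeff g = 0) {F : R k m}
    (h : evx _ (constantCoeff_update_x i hg) F = 0) : x k m i - g ∣ F := by
  have := sub_evx_mem (J := Ideal.span {x k m i - g}) (constantCoeff_update_x i hg)
    (fun l => by
      rcases eq_or_ne l i with rfl | hl
      · simp
      · simp [hl]) F
  rwa [h, sub_zero, Ideal.mem_span_singleton] at this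

theorem x_dvd_iff (i : Fin m) {F : R k m} :
    x k m i ∣ F ↔ evx _ (constantCoeff_update_x i (map_zero _)) F = 0 := by
  constructor
  · rintro ⟨G, rfl⟩
    rw [map_mul, evx_x, Function.update_self, zero_mul]
  · intro h
    simpa using x_sub_dvd (map_zero _) h

theorem prime_x (i : Fin m) : Prime (x k m i) := by
  refine ⟨?_, ?_, fun a b h => ?_⟩
  · intro h
    have := congrArg (coeff (Finsupp.single i.succ 1)) h
    rw [x, coeff_index_single_self_X] at this
    simp at this
  · intro h
    simpa [x] using h.map constantCoeff
  · simp only [x_dvd_iff, map_mul, mul_eq_zero] at h ⊢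
    exact h

/-! ### The ideals `Q₁` and `Q₂` -/

variable {f : Fin m → PowerSeries k}

theorem constantCoeff_subst_eq_zero_of {u : R k m} (hu : constantCoeff u = 0) {g : PowerSeries k}
    (hg : PowerSeries.constantCoeff g = 0) : constantCoeff (PowerSeries.subst u g) = 0 :=
  PowerSeries.constantCoeff_subst_eq_zero hu g hg

/-- The evaluation of power series on the curve `xᵢ = fᵢ(t)`, with values in `k[[t]] ⊆ R`. -/
def curveEval (f : Fin m → PowerSeries k) (hf : ∀ i, PowerSeries.constantCoeff (f i) = 0) :
    R k m →ₐ[k] R k m :=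
  evx (fun i => PowerSeries.subst (t k m) (f i))
    fun i => constantCoeff_subst_eq_zero_of constantCoeff_t (hf i)

/-- `Q₁` is the kernel of evaluation on the curve. -/
theorem mem_Q₁_iff (hf : ∀ i, PowerSeries.constantCoeff (f i) = 0) {F : R k m} :
    F ∈ Q₁ f ↔ curveEval f hf F = 0 := by
  constructor
  · intro h
    have : Q₁ f ≤ RingHom.ker (curveEval f hf) := by
      refine Ideal.span_le.2 ?_
      rintro _ ⟨i, rfl⟩
      change curveEval f hf _ = 0
      rw [map_sub, curveEval, evx_x, evx_subst_t, sub_self]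
    exact this h
  · intro h
    have := sub_evx_mem (J := Q₁ f)
      (fun i => constantCoeff_subst_eq_zero_of constantCoeff_t (hf i))
      (fun i => Ideal.subset_span ⟨i, rfl⟩) F
    rw [curveEval] at h
    rwa [h, sub_zero] at this

theorem isPrime_Q₁ (hf : ∀ i, PowerSeries.constantCoeff (f i) = 0) : (Q₁ f).IsPrime := by
  have : Q₁ f = RingHom.ker (curveEval f hf) := by
    ext F
    exact mem_Q₁_iff hf
  have : IsDomain (R k m) := NoZeroDivisors.to_isDomain _
  rw [‹Q₁ f = _›]
  exact RingHom.ker_isPrime _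

theorem map_sigma_Q₁ : (Q₁ f).map (sigma k m) = Q₂ f := by
  rw [Q₁, Ideal.map_span, ← Set.range_comp, Q₂]
  congr 2
  funext i
  simp [sigma_x, sigma_subst_t]

theorem map_sigma_Q₂ : (Q₂ f).map (sigma k m) = Q₁ f := by
  rw [Q₂, Ideal.map_span, ← Set.range_comp, Q₁]
  congr 2
  funext i
  simp [sigma_x, sigma_subst_neg_t]

theorem sigma_mem_Q₂ {F : R k m} (h : F ∈ Q₁ f) : sigma k m F ∈ Q₂ f := by
  rw [← map_sigma_Q₁]
  exact Ideal.mem_map_of_mem _ h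

theorem sigma_mem_Q₁ {F : R k m} (h : F ∈ Q₂ f) : sigma k m F ∈ Q₁ f := by
  rw [← map_sigma_Q₂]
  exact Ideal.mem_map_of_mem _ h

theorem isPrime_Q₂ (hf : ∀ i, PowerSeries.constantCoeff (f i) = 0) : (Q₂ f).IsPrime := by
  have := isPrime_Q₁ hf
  rw [← map_sigma_Q₁]
  exact Ideal.map_isPrime_of_equiv (sigma k m)

theorem contract_Q₂ : contract (Q₂ f) = contract (Q₁ f) := by
  ext ⟨F, hF⟩
  change F ∈ Q₂ f ↔ F ∈ Q₁ f
  constructor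
  · intro h
    simpa [sigma_eq_self_of_mem_S hF] using sigma_mem_Q₁ h
  · intro h
    simpa [sigma_eq_self_of_mem_S hF] using sigma_mem_Q₂ h

theorem contract_inf : contract (Q₁ f ⊓ Q₂ f) = contract (Q₁ f) := by
  have : contract (Q₁ f ⊓ Q₂ f) = contract (Q₁ f) ⊓ contract (Q₂ f) := Ideal.comap_inf _ _ _
  rw [this, contract_Q₂, inf_idem]

/-! ### The maximal ideal of `S` -/

/-- The substitution `F(t, x₁, …, xₘ) ↦ F(t², x₁, …, xₘ)` with values in `S`. -/
def toS : R k m →ₐ[k] S k m := (substSq k m).rangeRestrict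

/-- The constant term of a series can be split off modulo `𝔪`. -/
theorem sub_constantCoeff_mem_maxIdeal (F : R k m) :
    toS F - algebraMap k (S k m) (constantCoeff F) ∈ maxIdeal k m := by
  have h0 : ∀ i : Fin (m + 1), constantCoeff ((0 : Fin (m + 1) → R k m) i) = 0 := fun i => by simp
  have h := Ideal.mem_map_of_mem (toS (k := k) (m := m)) (sub_ev_mem h0 F)
  have hc : ev _ h0 F = algebraMap k (R k m) (constantCoeff F) := by
    rw [ev, substAlgHom_apply]
    exact subst_zero_eq_C_constantCoeff
  rw [hc, map_sub, AlgHom.commutes, Ideal.map_span, ← Set.range_comp] at h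
  refine Ideal.span_le.2 ?_ h
  rintro _ ⟨i, rfl⟩
  refine Ideal.subset_span ?_
  refine Fin.cases (Or.inl ?_) (fun j => Or.inr ⟨j, ?_⟩) i
  · refine Subtype.ext ?_
    change substSq k m (X 0 - 0) = t k m ^ 2
    rw [sub_zero]
    exact substAlgHom_X (hasSubst_sq k m) 0
  · refine Subtype.ext ?_
    change x k m j = substSq k m (X j.succ - 0)
    rw [sub_zero]
    exact (substAlgHom_X (hasSubst_sq k m) j.succ).symm

theorem mem_maxIdeal_of_constantCoeff {F : S k m} (hF : constantCoeff (F : R k m) = 0) :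
    F ∈ maxIdeal k m := by
  have hle : maxIdeal k m ≤
      RingHom.ker ((constantCoeff (σ := Fin (m + 1)) (R := k)).comp (S k m).val.toRingHom) := by
    refine Ideal.span_le.2 ?_
    rintro _ (rfl | ⟨i, rfl⟩)
    · change constantCoeff (t k m ^ 2) = 0
      simp [constantCoeff_t]
    · exact constantCoeff_x i
  obtain ⟨G, rfl⟩ : ∃ G, toS G = F := (substSq k m).rangeRestrict_surjective F
  have h := sub_constantCoeff_mem_maxIdeal G
  have h' : constantCoeff ((toS G -
    algebraMap k (S k m) (constantCoeff G) : S k m) : R k m) = 0 := hle h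
  have hG : constantCoeff G = 0 := by
    rw [AddSubgroupClass.coe_sub, map_sub, hF, zero_sub, neg_eq_zero] at h'
    simpa using! h'
  rwa [hG, map_zero, sub_zero] at h

theorem contract_Q₁_le_maxIdeal (hf : ∀ i, PowerSeries.constantCoeff (f i) = 0) :
    contract (Q₁ f) ≤ maxIdeal k m := by
  intro F hF
  refine mem_maxIdeal_of_constantCoeff ?_
  have : Q₁ f ≤ RingHom.ker (constantCoeff (σ := Fin (m + 1)) (R := k)) := by
    refine Ideal.span_le.2 ?_
    rintro _ ⟨i, rfl⟩
    change constantCoeff _ = 0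
    rw [map_sub, constantCoeff_x, constantCoeff_subst_eq_zero_of constantCoeff_t (hf i), sub_zero]
  exact this hF

/-! ### Averaging over `σ` -/

/-- The projection `F ↦ (F + σ F) / 2` of `R` onto `S`. -/
def average [CharZero k] (F : R k m) : S k m :=
  ⟨(2⁻¹ : k) • (F + sigma k m F), mem_S_iff.2 (by
    rw [map_smul, map_add, sigma_sigma, add_comm F])⟩

theorem coe_average [CharZero k] (F : R k m) :
    (average F : R k m) = (2⁻¹ : k) • (F + sigma k m F) := rfl

/-- A member of `S` that is a combination of elements of `S` over `R` is one over `S`. -/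
theorem exists_coeff_in_S [CharZero k] {ι : Type*} [Fintype ι] {z : ι → S k m} {r : S k m}
    (h : (r : R k m) ∈ Ideal.span (Set.range fun i => (z i : R k m))) :
    ∃ d : ι → S k m, r = ∑ i, d i * z i := by
  obtain ⟨e, he⟩ := Ideal.mem_span_range_iff_exists_fun.1 h
  refine ⟨fun i => average (e i), Subtype.ext ?_⟩
  have hr := sigma_eq_self_of_mem_S r.2
  have hz i := sigma_eq_self_of_mem_S (z i).2
  have h1 : ∑ i, sigma k m (e i) * z i = (r : R k m) := by
    rw [← hr, ← he, map_sum]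
    simp only [map_mul, hz]
  rw [AddSubmonoidClass.coe_finsetSum]
  simp only [MulMemClass.coe_mul, coe_average, smul_mul_assoc, add_mul]
  rw [← Finset.smul_sum, Finset.sum_add_distrib, he, h1, ← two_smul k, smul_smul,
    inv_mul_cancel₀ two_ne_zero, one_smul]

/-! ### Symbolic squares and first-order deformations of the curve -/

/-- No Noetherian hypothesis is needed: `P` is the annihilator of the class of `1` in `A ⧸ P`. -/
theorem exists_mul_mem_of_mem_symbolicPower {A : Type*} [CommRing A] {P : Ideal A} [hP : P.IsPrime]
    {n : ℕ} {r : A} (hr : r ∈ symbolicPower P n) : ∃ w, w ∉ P ∧ w * r ∈ P ^ n := by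
  have hass : P ∈ associatedPrimes A (A ⧸ P) := by
    refine ⟨hP, Ideal.Quotient.mk P 1, ?_⟩
    have : (⊥ : Submodule A (A ⧸ P)).colon {Ideal.Quotient.mk P 1} = P := by
      ext a
      rw [Submodule.mem_colon_singleton, Submodule.mem_bot, ← Ideal.Quotient.mk_eq_mk,
        ← Submodule.Quotient.mk_smul, Submodule.Quotient.mk_eq_zero, smul_eq_mul, mul_one]
    rw [this, hP.radical]
  have h := (mem_symbolicPower P n r).1 hr P hass
  obtain ⟨w, hw, h⟩ := (IsLocalization.algebraMap_mem_map_algebraMap_iff P.primeCompl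
    (Localization.AtPrime P) _ _).1 h
  exact ⟨w, hw, h⟩

theorem mem_of_mem_symbolicPower {A : Type*} [CommRing A] {P : Ideal A} [hP : P.IsPrime]
    {n : ℕ} (hn : n ≠ 0) {r : A} (hr : r ∈ symbolicPower P n) : r ∈ P := by
  obtain ⟨w, hw, h⟩ := exists_mul_mem_of_mem_symbolicPower hr
  exact (hP.mem_or_mem (Ideal.pow_le_self hn h)).resolve_left hw

theorem constantCoeff_deform (hf : ∀ i, PowerSeries.constantCoeff (f i) = 0)
    (i l : Fin m) : constantCoeff
    (PowerSeries.subst (t k m) (f l) + (Pi.single i (x k m i) : Fin m → R k m) l) = 0 := by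
  rw [map_add, constantCoeff_subst_eq_zero_of constantCoeff_t (hf l), zero_add]
  rcases eq_or_ne l i with rfl | h
  · simp [constantCoeff_x]
  · simp [h]

/-- Evaluation on the family of curves obtained from `xₗ = fₗ(t)` by moving the `i`-th coordinate:
`xᵢ ↦ fᵢ(t) + xᵢ` and `xₗ ↦ fₗ(t)` for `l ≠ i`. The variable `xᵢ` of the target is the deformation
parameter, so the coefficient of `xᵢ` plays the part of `∂/∂xᵢ` along the curve. -/
def deform (hf : ∀ i, PowerSeries.constantCoeff (f i) = 0)
    (i : Fin m) : R k m →ₐ[k] R k m := evx _ (constantCoeff_deform hf i)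

/-- At parameter value zero the deformed curve is the original one. -/
theorem x_dvd_deform_iff (hf : ∀ i, PowerSeries.constantCoeff (f i) = 0)
    (i : Fin m) {F : R k m} : x k m i ∣ deform hf i F ↔ F ∈ Q₁ f := by
  rw [mem_Q₁_iff hf, x_dvd_iff, deform, curveEval, evx_evx]
  intro l
  rw [map_add, evx_subst_t]
  rcases eq_or_ne l i with rfl | h
  · simp [evx_x]
  · simp [h]

/-- Elements of the symbolic square of `P` vanish to second order along every deformation of the
curve. A multiplier outside `P` is harmless, since `xᵢ` is prime and does not divide its image. -/
theorem x_sq_dvd_deform (hf : ∀ i, PowerSeries.constantCoeff (f i) = 0)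
    {r : S k m} (hr : r ∈ symbolicPower (contract (Q₁ f)) 2) (i : Fin m) :
    x k m i ^ 2 ∣ deform hf i r := by
  have := isPrime_Q₁ hf
  have : (contract (Q₁ f)).IsPrime := Ideal.comap_isPrime _ _
  obtain ⟨w, hw, h⟩ := exists_mul_mem_of_mem_symbolicPower hr
  have hP : (contract (Q₁ f)).map ((deform hf i).comp (S k m).val) ≤ Ideal.span {x k m i} := by
    rw [Ideal.map_le_iff_le_comap]
    intro F hF
    exact Ideal.mem_span_singleton.2 ((x_dvd_deform_iff hf i).2 hF)
  have h2 := Ideal.mem_map_of_mem ((deform hf i).comp (S k m).val) h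
  rw [Ideal.map_pow] at h2
  have h3 := Ideal.pow_right_mono hP 2 h2
  rw [Ideal.span_singleton_pow, Ideal.mem_span_singleton, map_mul] at h3
  exact (prime_x i).pow_dvd_of_dvd_mul_left 2 (fun h => hw ((x_dvd_deform_iff hf i).1 h)) h3

/-! ### Generators of `Q₁` and `Q₂` and their differences -/

/-- The generator `xᵢ - fᵢ(t)` of `Q₁`. -/
def u (f : Fin m → PowerSeries k) (i : Fin m) : R k m := x k m i - PowerSeries.subst (t k m) (f i)

/-- The generator `xᵢ - fᵢ(-t)` of `Q₂`. -/
def v (f : Fin m → PowerSeries k) (i : Fin m) : R k m := x k m i - PowerSeries.subst (-t k m) (f i)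

/-- Twice the odd part `fᵢ(t) - fᵢ(-t)` of `fᵢ`. -/
def oddPart (f : Fin m → PowerSeries k) (i : Fin m) : R k m :=
  PowerSeries.subst (t k m) (f i) - PowerSeries.subst (-t k m) (f i)

theorem v_eq (i : Fin m) : v f i = u f i + oddPart f i := by rw [u, v, oddPart]; ring

theorem sigma_u (i : Fin m) : sigma k m (u f i) = v f i := by
  rw [u, v, map_sub, sigma_x, sigma_subst_t]

theorem sigma_v (i : Fin m) : sigma k m (v f i) = u f i := by rw [← sigma_u, sigma_sigma]

theorem sigma_oddPart (i : Fin m) : sigma k m (oddPart f i) = -oddPart f i := by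
  rw [oddPart, map_sub, sigma_subst_t, sigma_subst_neg_t, neg_sub]

theorem u_mem (i : Fin m) : u f i ∈ Q₁ f := Ideal.subset_span ⟨i, rfl⟩

theorem evx_oddPart {y : Fin m → R k m} (hy : ∀ i, constantCoeff (y i) = 0) (i : Fin m) :
    evx y hy (oddPart f i) = oddPart f i := by
  rw [oddPart, map_sub, evx_subst_t, evx_subst_neg_t]

theorem deform_u (hf : ∀ i, PowerSeries.constantCoeff (f i) = 0)
    (i l : Fin m) :
    deform hf i (u f l) = (Pi.single i (x k m i) : Fin m → R k m) l := by
  rw [deform, u, map_sub, evx_x, evx_subst_t, add_sub_cancel_left]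

theorem v_mem_Q₁_iff (hf : ∀ i, PowerSeries.constantCoeff (f i) = 0)
    (i : Fin m) : v f i ∈ Q₁ f ↔ oddPart f i = 0 := by
  rw [mem_Q₁_iff hf, v_eq, map_add, (mem_Q₁_iff hf).1 (u_mem i), zero_add, curveEval, evx_oddPart]

theorem mul_mem_maxIdeal_mul (hf : ∀ i, PowerSeries.constantCoeff (f i) = 0)
    {a b : S k m} (ha : (a : R k m) ∈ Q₁ f) (hb : (b : R k m) ∈ Q₁ f) :
    a * b ∈ maxIdeal k m * contract (Q₁ f) :=
  Ideal.mul_mem_mul (contract_Q₁_le_maxIdeal hf ha) hb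

/-! ### Curves with all `fᵢ` even -/

/-- Here `P` is generated by the `xᵢ - fᵢ(t)`, and the `i`-th deformation reads off the `i`-th
coefficient of a combination of them. -/
theorem symbolicPower_le_of_oddPart_eq_zero (hf : ∀ i, PowerSeries.constantCoeff (f i) = 0)
    [CharZero k] (h0 : ∀ i, oddPart f i = 0) :
    symbolicPower (contract (Q₁ f)) 2 ≤ maxIdeal k m * contract (Q₁ f) := by
  intro r hr
  have := isPrime_Q₁ hf
  have : (contract (Q₁ f)).IsPrime := Ideal.comap_isPrime _ _
  have hinv : ∀ i, u f i ∈ S k m := fun i => by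
    rw [mem_S_iff, sigma_u, v_eq, h0, add_zero]
  have hrP : r ∈ contract (Q₁ f) := mem_of_mem_symbolicPower two_ne_zero hr
  obtain ⟨d, hd⟩ := exists_coeff_in_S (z := fun i => ⟨u f i, hinv i⟩) (r := r) hrP
  have hdP : ∀ i, (d i : R k m) ∈ Q₁ f := by
    intro i
    have hdvd := x_sq_dvd_deform hf hr i
    rw [hd, AddSubmonoidClass.coe_finsetSum, map_sum, Finset.sum_eq_single i] at hdvd
    · rw [MulMemClass.coe_mul, map_mul, deform_u, Pi.single_eq_same, sq] at hdvd
      exact (x_dvd_deform_iff hf i).1 ((mul_dvd_mul_iff_right (prime_x i).ne_zero).1 hdvd)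
    · intro l _ hl
      rw [MulMemClass.coe_mul, map_mul, deform_u, Pi.single_eq_of_ne hl, mul_zero]
    · simp
  rw [hd]
  exact Ideal.sum_mem _ fun i _ => mul_mem_maxIdeal_mul hf (hdP i) (u_mem i)

/-! ### Curves with a nonzero odd part -/

/-- Since divisibility is total in `k[[t]]`, some nonzero odd part divides all the others, with
quotients in `k[[t]]`. -/
theorem exists_oddPart_dvd (h : ∃ i, oddPart f i ≠ 0) :
    ∃ j, oddPart f j ≠ 0 ∧ ∃ c : Fin m → PowerSeries k,
      ∀ i, oddPart f i = oddPart f j * PowerSeries.subst (t k m) (c i) := by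
  obtain ⟨i₀, hi₀⟩ := h
  have ht : PowerSeries.HasSubst (t k m) :=
    PowerSeries.HasSubst.of_constantCoeff_zero constantCoeff_t
  have hX : PowerSeries.HasSubst (-PowerSeries.X : PowerSeries k) :=
    PowerSeries.HasSubst.of_constantCoeff_zero' (by simp)
  let δ : Fin m → PowerSeries k := fun i => f i - (f i).subst (-PowerSeries.X : PowerSeries k)
  have hδ : ∀ i, PowerSeries.subst (t k m) (δ i) = oddPart f i := by
    intro i
    rw [PowerSeries.subst_sub ht, PowerSeries.subst_comp_subst_apply hX ht, oddPart]
    congr 2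
    rw [← PowerSeries.coe_substAlgHom ht, map_neg, PowerSeries.coe_substAlgHom,
      PowerSeries.subst_X ht]
  have : Nonempty (Fin m) := ⟨i₀⟩
  have hdir : Directed (fun a b : PowerSeries k => b ∣ a) δ := fun i l => by
    rcases ValuationRing.dvd_total (δ i) (δ l) with h | h
    · exact ⟨i, dvd_rfl, h⟩
    · exact ⟨l, h, dvd_rfl⟩
  have : IsTrans (PowerSeries k) (fun a b => b ∣ a) := ⟨fun a b c h h' => h'.trans h⟩
  obtain ⟨j, hj⟩ := hdir.finite_le id
  choose c hc using hj
  have hc' : ∀ i, oddPart f i = oddPart f j * PowerSeries.subst (t k m) (c i) := fun i => by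
    rw [← hδ, ← hδ, ← PowerSeries.subst_mul ht, ← hc, id]
  refine ⟨j, fun h => hi₀ ?_, c, hc'⟩
  rw [hc', h, zero_mul]

variable {j : Fin m} {c : Fin m → PowerSeries k}

/-- The linear generator `xᵢ - fᵢ(t) - cᵢ(t) (xⱼ - fⱼ(t))` of `P`; it vanishes for `i = j`. -/
def z (f c : Fin m → PowerSeries k) (j i : Fin m) : R k m :=
  u f i - PowerSeries.subst (t k m) (c i) * u f j

/-- The quotient of two odd series is even. -/
theorem sigma_subst_c (hj : oddPart f j ≠ 0)
    (hc : ∀ i, oddPart f i = oddPart f j * PowerSeries.subst (t k m) (c i))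
    (i : Fin m) :
    sigma k m (PowerSeries.subst (t k m) (c i)) = PowerSeries.subst (t k m) (c i) := by
  have h := congrArg (sigma k m) (hc i)
  rw [map_mul, sigma_oddPart, sigma_oddPart, hc i, neg_mul, neg_inj] at h
  exact (mul_left_cancel₀ hj h).symm

theorem subst_c_self (hj : oddPart f j ≠ 0)
    (hc : ∀ i, oddPart f i = oddPart f j * PowerSeries.subst (t k m) (c i)) :
    PowerSeries.subst (t k m) (c j) = 1 :=
  (mul_left_cancel₀ hj ((mul_one _).trans (hc j))).symm

theorem z_self (hj : oddPart f j ≠ 0)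
    (hc : ∀ i, oddPart f i = oddPart f j * PowerSeries.subst (t k m) (c i)) :
    z f c j j = 0 := by
  rw [z, subst_c_self hj hc, one_mul, sub_self]

theorem sigma_z (hj : oddPart f j ≠ 0)
    (hc : ∀ i, oddPart f i = oddPart f j * PowerSeries.subst (t k m) (c i))
    (i : Fin m) : sigma k m (z f c j i) = z f c j i := by
  rw [z, map_sub, map_mul, sigma_u, sigma_u, sigma_subst_c hj hc, v_eq, v_eq, hc i]
  ring

theorem z_mem (i : Fin m) : z f c j i ∈ Q₁ f :=
  sub_mem (u_mem i) (Ideal.mul_mem_left _ _ (u_mem j))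

theorem constantCoeff_u (hf : ∀ i, PowerSeries.constantCoeff (f i) = 0) (i : Fin m) :
    constantCoeff (u f i) = 0 := by
  rw [u, map_sub, constantCoeff_x, constantCoeff_subst_eq_zero_of constantCoeff_t (hf i), sub_zero]

theorem constantCoeff_x_sub_z (hf : ∀ i, PowerSeries.constantCoeff (f i) = 0) (i : Fin m) :
    constantCoeff (x k m i - z f c j i) = 0 := by
  rw [z, map_sub, map_sub, map_mul, constantCoeff_u hf, constantCoeff_u hf, constantCoeff_x]
  simp

/-- Elimination of the variables `xᵢ`, `i ≠ j`, modulo the linear generators `zᵢ`. -/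
def elim (hf : ∀ i, PowerSeries.constantCoeff (f i) = 0) (c : Fin m → PowerSeries k) (j : Fin m) :
    R k m →ₐ[k] R k m :=
  evx (fun i => x k m i - z f c j i) (constantCoeff_x_sub_z hf)

theorem elim_u (hf : ∀ i, PowerSeries.constantCoeff (f i) = 0) (i : Fin m) :
    elim hf c j (u f i) = PowerSeries.subst (t k m) (c i) * u f j := by
  rw [elim, u, map_sub, evx_x, evx_subst_t, z, u]
  ring

theorem sub_elim_mem (hf : ∀ i, PowerSeries.constantCoeff (f i) = 0) (F : R k m) :
    F - elim hf c j F ∈ Ideal.span (Set.range (z f c j)) :=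
  sub_evx_mem _ (fun i => by
    rw [sub_sub_cancel]
    exact Ideal.subset_span ⟨i, rfl⟩) F

theorem sigma_elim (hf : ∀ i, PowerSeries.constantCoeff (f i) = 0) (hj : oddPart f j ≠ 0)
    (hc : ∀ i, oddPart f i = oddPart f j * PowerSeries.subst (t k m) (c i)) (F : R k m) :
    sigma k m (elim hf c j F) = elim hf c j (sigma k m F) := by
  have hb : ∀ i, constantCoeff
      ((Fin.cons (-t k m) (fun i => x k m i - z f c j i) : Fin (m + 1) → R k m) i) = 0 := by
    intro i
    refine Fin.cases ?_ (fun l => ?_) i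
    · simp [constantCoeff_t]
    · exact constantCoeff_x_sub_z hf l
  have h1 : sigma k m (elim hf c j F) = ev _ hb F := by
    rw [sigma_eq_ev, elim, evx]
    refine ev_ev _ _ _ (fun i => ?_) F
    rw [← sigma_eq_ev]
    refine Fin.cases sigma_t (fun l => ?_) i
    rw [Fin.cons_succ, Fin.cons_succ, map_sub, sigma_x, sigma_z hj hc]
  have h2 : elim hf c j (sigma k m F) = ev _ hb F := by
    rw [sigma_eq_ev, elim, evx]
    refine ev_ev _ _ _ (fun i => ?_) F
    refine Fin.cases ?_ (fun l => ?_) i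
    · exact (map_neg _ _).trans (congrArg _ (evx_t (constantCoeff_x_sub_z hf)))
    · exact evx_x (constantCoeff_x_sub_z hf) l
  rw [h1, h2]

/-- A `σ`-invariant multiple of `uⱼ` is also a multiple of `vⱼ = σ uⱼ`, hence of the product, because
the two are distinct linear factors. The cofactor is again invariant. -/
theorem exists_eq_mul_u_mul_v [CharZero k] (hf : ∀ i, PowerSeries.constantCoeff (f i) = 0)
    (hj : oddPart f j ≠ 0) {F : R k m} (hF : sigma k m F = F) (h : u f j ∣ F) :
    ∃ g : S k m, F = g * (u f j * v f j) := by
  obtain ⟨H, rfl⟩ := h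
  have hq : constantCoeff (PowerSeries.subst (-t k m) (f j)) = 0 :=
    constantCoeff_subst_eq_zero_of (by simp [constantCoeff_t]) (hf j)
  -- `ν` evaluates at the second root `xⱼ = fⱼ(-t)`; it kills `vⱼ` but not `uⱼ`.
  let ν := evx _ (constantCoeff_update_x j hq)
  have hνv : ν (v f j) = 0 := by
    rw [v, map_sub, evx_x, Function.update_self, evx_subst_neg_t, sub_self]
  have hνu : ν (u f j) ≠ 0 := by
    have : ν (v f j) = ν (u f j) + oddPart f j := by rw [v_eq, map_add, evx_oddPart]
    intro h0
    rw [hνv, h0, zero_add] at this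
    exact hj this.symm
  have hH : ν H = 0 := by
    have h := congrArg ν hF
    rw [map_mul, sigma_u, map_mul, hνv, zero_mul, map_mul] at h
    exact (mul_eq_zero.1 h.symm).resolve_left hνu
  obtain ⟨g, rfl⟩ : v f j ∣ H := x_sub_dvd hq hH
  have huv : u f j * v f j ≠ 0 := by
    refine mul_ne_zero (fun h0 => hνu (by rw [h0, map_zero])) fun h0 => hνu ?_
    rw [← sigma_v, h0, map_zero, map_zero]
  have hg : sigma k m g = g := by
    rw [map_mul, map_mul, sigma_u, sigma_v, ← mul_assoc, ← mul_assoc, mul_comm (v f j)] at hF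
    exact mul_left_cancel₀ huv hF
  exact ⟨⟨g, mem_S_iff.2 hg⟩, by ring⟩

/-- The ideal `P` is generated by the `zᵢ` together with `uⱼ vⱼ = (xⱼ - fⱼ(t)) (xⱼ - fⱼ(-t))`.
Eliminating the `xᵢ` with `i ≠ j` leaves a `σ`-invariant multiple of `uⱼ`. -/
theorem exists_coeff_of_mem_contract [CharZero k]
    (hf : ∀ i, PowerSeries.constantCoeff (f i) = 0) (hj : oddPart f j ≠ 0)
    (hc : ∀ i, oddPart f i = oddPart f j * PowerSeries.subst (t k m) (c i)) {r : S k m}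
    (hr : r ∈ contract (Q₁ f)) :
    ∃ (d : Fin m → S k m) (g : S k m),
      (r : R k m) = ∑ i, d i * z f c j i + g * (u f j * v f j) := by
  have hz : ∀ i, z f c j i ∈ S k m := fun i => mem_S_iff.2 (sigma_z hj hc i)
  have hinv : sigma k m (elim hf c j r) = elim hf c j r := by
    rw [sigma_elim hf hj hc, sigma_eq_self_of_mem_S r.2]
  have hu : u f j ∣ elim hf c j r := by
    have h := Ideal.mem_map_of_mem (elim hf c j) (show (r : R k m) ∈ Q₁ f from hr)
    rw [Q₁, Ideal.map_span, ← Set.range_comp] at h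
    refine Ideal.mem_span_singleton.1 (Ideal.span_le.2 ?_ h)
    rintro _ ⟨i, rfl⟩
    exact Ideal.mem_span_singleton.2 ⟨_, (elim_u hf i).trans (mul_comm _ _)⟩
  obtain ⟨g, hg⟩ := exists_eq_mul_u_mul_v hf hj hinv hu
  obtain ⟨d, hd⟩ := exists_coeff_in_S (z := fun i => ⟨z f c j i, hz i⟩)
    (r := r - ⟨elim hf c j r, mem_S_iff.2 hinv⟩) (sub_elim_mem hf (r : R k m))
  refine ⟨d, g, ?_⟩
  have := congrArg (Subtype.val) hd
  rw [AddSubgroupClass.coe_sub, AddSubmonoidClass.coe_finsetSum] at this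
  rw [← hg]
  exact sub_eq_iff_eq_add.1 this

/-- The deformations with `i ≠ j` read off the coefficients of the `zᵢ`, and then the `j`-th one reads
off that of `uⱼ vⱼ`, up to the factor `vⱼ`, which does not vanish on the curve. -/
theorem symbolicPower_le_of_oddPart_ne_zero [CharZero k]
    (hf : ∀ i, PowerSeries.constantCoeff (f i) = 0) (hj : oddPart f j ≠ 0)
    (hc : ∀ i, oddPart f i = oddPart f j * PowerSeries.subst (t k m) (c i)) :
    symbolicPower (contract (Q₁ f)) 2 ≤ maxIdeal k m * contract (Q₁ f) := by
  intro r hr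
  have hprime := isPrime_Q₁ hf
  have : (contract (Q₁ f)).IsPrime := Ideal.comap_isPrime _ _
  have hrP : r ∈ contract (Q₁ f) := mem_of_mem_symbolicPower two_ne_zero hr
  have hz : ∀ i, z f c j i ∈ S k m := fun i => mem_S_iff.2 (sigma_z hj hc i)
  have huv : u f j * v f j ∈ S k m := mem_S_iff.2 (by rw [map_mul, sigma_u, sigma_v, mul_comm])
  obtain ⟨d, g, hdg⟩ := exists_coeff_of_mem_contract hf hj hc hrP
  have hdP : ∀ i, i ≠ j → (d i : R k m) ∈ Q₁ f := by
    intro i hi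
    have huj : deform hf i (u f j) = 0 := by rw [deform_u, Pi.single_eq_of_ne hi.symm]
    have hdvd := x_sq_dvd_deform hf hr i
    rw [hdg, map_add, map_mul _ (g : R k m), map_mul _ (u f j), huj, zero_mul, mul_zero, add_zero,
      map_sum, Finset.sum_eq_single i] at hdvd
    · rw [map_mul, z, map_sub, map_mul _ _ (u f j), huj, mul_zero, sub_zero, deform_u,
        Pi.single_eq_same, sq] at hdvd
      exact (x_dvd_deform_iff hf i).1 ((mul_dvd_mul_iff_right (prime_x i).ne_zero).1 hdvd)
    · intro l _ hl
      rw [map_mul, z, map_sub, map_mul _ _ (u f j), huj, mul_zero, sub_zero, deform_u,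
        Pi.single_eq_of_ne hl, mul_zero]
    · simp
  have hgP : (g : R k m) ∈ Q₁ f := by
    have hdvd := x_sq_dvd_deform hf hr j
    have hsum : x k m j ^ 2 ∣ deform hf j (∑ i, (d i : R k m) * z f c j i) := by
      rw [map_sum]
      refine Finset.dvd_sum fun i _ => ?_
      rcases eq_or_ne i j with rfl | hi
      · rw [z_self hj hc, mul_zero, map_zero]
        exact dvd_zero _
      · rw [map_mul, sq]
        exact mul_dvd_mul ((x_dvd_deform_iff hf j).2 (hdP i hi))
          ((x_dvd_deform_iff hf j).2 (z_mem i))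
    rw [hdg, map_add, dvd_add_right hsum, map_mul, map_mul, deform_u, Pi.single_eq_same,
      mul_left_comm, sq, mul_dvd_mul_iff_left (prime_x j).ne_zero, ← map_mul,
      x_dvd_deform_iff] at hdvd
    exact (hprime.mem_or_mem hdvd).resolve_right fun h => hj ((v_mem_Q₁_iff hf j).1 h)
  have hr' : r = ∑ i, d i * ⟨z f c j i, hz i⟩ + g * ⟨u f j * v f j, huv⟩ := by
    refine Subtype.ext (hdg.trans ?_)
    rw [AddMemClass.coe_add, AddSubmonoidClass.coe_finsetSum]
    rfl
  rw [hr']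
  refine add_mem (Ideal.sum_mem _ fun i _ => ?_)
    (mul_mem_maxIdeal_mul hf hgP (Ideal.mul_mem_right _ _ (u_mem j)))
  rcases eq_or_ne i j with rfl | hi
  · have : (⟨z f c i i, hz i⟩ : S k m) = 0 := Subtype.ext (z_self hj hc)
    rw [this, mul_zero]
    exact zero_mem _
  · exact mul_mem_maxIdeal_mul hf (hdP i hi) (z_mem i)

theorem symbolicPower_le [CharZero k] (hf : ∀ i, PowerSeries.constantCoeff (f i) = 0) :
    symbolicPower (contract (Q₁ f)) 2 ≤ maxIdeal k m * contract (Q₁ f) := by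
  by_cases h0 : ∀ i, oddPart f i = 0
  · exact symbolicPower_le_of_oddPart_eq_zero hf h0
  · obtain ⟨j, hj, c, hc⟩ := exists_oddPart_dvd (not_forall.1 h0)
    exact symbolicPower_le_of_oddPart_ne_zero hf hj hc

end EisenbudMazur

end

theorem theorem2p1 (k : Type*) [Field k] [CharZero k] (m : ℕ) (f : Fin m → PowerSeries k)
    (hf : ∀ i, PowerSeries.constantCoeff (f i) = 0) :
    (EisenbudMazur.Q₁ f).IsPrime ∧ (EisenbudMazur.Q₂ f).IsPrime ∧
    (EisenbudMazur.Q₁ f).map (EisenbudMazur.sigma k m) = EisenbudMazur.Q₂ f ∧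
    (EisenbudMazur.Q₂ f).map (EisenbudMazur.sigma k m) = EisenbudMazur.Q₁ f ∧
    ∃ P : Ideal (EisenbudMazur.S k m),
      P.IsPrime ∧
      P = EisenbudMazur.contract (EisenbudMazur.Q₁ f) ∧
      P = EisenbudMazur.contract (EisenbudMazur.Q₂ f) ∧
      P = EisenbudMazur.contract (EisenbudMazur.Q₁ f ⊓ EisenbudMazur.Q₂ f) ∧
      EisenbudMazur.symbolicPower P 2 ≤ EisenbudMazur.maxIdeal k m * P := by
  have hQ := EisenbudMazur.isPrime_Q₁ hf
  exact ⟨hQ, EisenbudMazur.isPrime_Q₂ hf, EisenbudMazur.map_sigma_Q₁, EisenbudMazur.map_sigma_Q₂,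
    EisenbudMazur.contract (EisenbudMazur.Q₁ f), Ideal.comap_isPrime _ _, rfl,
    EisenbudMazur.contract_Q₂.symm, EisenbudMazur.contract_inf.symm,
    EisenbudMazur.symbolicPower_le hf⟩
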